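/- Let $A$ and $B$ be nonzero finite-dimensional quantum systems. A quantum instrument from $A$ to $B$ is a finite family $\{\mathcal M_j\}$ of completely positive trace-nonincreasing linear maps, from operators on $A$ to operators on $B$, whose sum is completely positive and trace-preserving. A twisted channel is a map of the form $\sum_j s_j\mathcal M_j$ with $s_j\in\{+1,-1\}$ and $\{\mathcal M_j\}$ a quantum instrument; $\mathrm{TC}$ is the set of twisted channels. For a Hermitian-preserving linear map $\mathcal E$ from operators on $A$ to operators on $B$, the diamond norm is $$\|\mathcal E\|_\diamond=\max_{\rho_{A'A}}\bigl\|(\mathrm{id}_{A'}\otimes\mathcal E)(\rho_{A'A})\bigr\|_1,$$ where the maximum is over all states of $A'A$, $\dim A'=\dim A$, and $\|\cdot\|_1$ is the trace norm; the absolute robustness is $$R(\mathcal E)=\min\Bigl\{\lambda\ge 0\ \Big|\ \tfrac{\mathcal E+\lambda\mathcal T}{1+\lambda}\in\mathrm{TC}\ \text{for some}\ \mathcal T\in\mathrm{TC}\Bigr\}.$$ **Proposition.** For every Hermitian-preserving map $\mathcal E$, the maximum and the minimum above are attained, and $$R(\mathcal E)=\max\Bigl\{0,\ \frac{\|\mathcal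 E\|_\diamond-1}{2}\Bigr\}.$$ In particular, whenever $\|\mathcal E\|_\diamond\ge 1$, $$R(\mathcal E)=\frac{\|\mathcal E\|_\diamond-1}{2},\qquad\text{equivalently}\qquad \|\mathcal E\|_\diamond=2R(\mathcal E)+1.$$ -/

import Mathlib

open scoped Matrix Kronecker ComplexOrder

namespace QuantumMap

/-- Linear maps from operators on a system `A` to operators on a system `B`: the Hilbert spaces are
`ℂ^A` and `ℂ^B`, with finite index types `A` and `B`. -/
abbrev OpMap (A B : Type*) : Type _ := Matrix A A ℂ →ₗ[ℂ] Matrix B B ℂ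

variable {A B : Type*}

/-- The map `id_C ⊗ E` on operators of the composite system `C ⊗ A`: it applies `E` to each
`A`-block. It is characterized by its values on product operators, see `idTensor_kronecker`. -/
def idTensor (C : Type*) (E : OpMap A B) : OpMap (C × A) (C × B) where
  toFun X := Matrix.of fun p q => E (Matrix.of fun a a' => X (p.1, a) (q.1, a')) p.2 q.2
  map_add' X Y := by
    ext p q
    exact congrFun (congrFun (E.map_add (Matrix.of fun a a' => X (p.1, a) (q.1, a'))
      (Matrix.of fun a a' => Y (p.1, a) (q.1, a'))) p.2) q.2
  map_smul' c X := by
    ext p q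
    exact congrFun (congrFun (E.map_smul c (Matrix.of fun a a' => X (p.1, a) (q.1, a'))) p.2) q.2

theorem idTensor_kronecker {C : Type*} (E : OpMap A B) (Y : Matrix C C ℂ) (X : Matrix A A ℂ) :
    idTensor C E (Y ⊗ₖ X) = Y ⊗ₖ E X := by
  ext p q
  exact congrFun (congrFun (E.map_smul (Y p.1 q.1) X) p.2) q.2

/-- `E` maps Hermitian operators to Hermitian operators. -/
def IsHermitianPreserving (E : OpMap A B) : Prop :=
  ∀ X : Matrix A A ℂ, X.IsHermitian → (E X).IsHermitian

/-- `id ⊗ E` preserves positive semidefiniteness for every finite-dimensional reference system. -/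
def IsCompletelyPositive (E : OpMap A B) : Prop :=
  ∀ (n : ℕ) (X : Matrix (Fin n × A) (Fin n × A) ℂ),
    X.PosSemidef → (idTensor (Fin n) E X).PosSemidef

variable [Fintype A] [Fintype B]

def IsTracePreserving (E : OpMap A B) : Prop :=
  ∀ X : Matrix A A ℂ, (E X).trace = X.trace

/-- `E` does not increase the (real) trace of positive semidefinite operators. -/
def IsTraceNonincreasing (E : OpMap A B) : Prop :=
  ∀ X : Matrix A A ℂ, X.PosSemidef → (E X).trace.re ≤ X.trace.re

/-- Completely positive and trace-nonincreasing. -/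
def IsCPTN (E : OpMap A B) : Prop :=
  IsCompletelyPositive E ∧ IsTraceNonincreasing E

/-- Completely positive and trace-preserving (a quantum channel). -/
def IsCPTP (E : OpMap A B) : Prop :=
  IsCompletelyPositive E ∧ IsTracePreserving E

/-- A finite collection of CPTN maps whose sum is CPTP. -/
def IsQuantumInstrument {n : ℕ} (M : Fin n → OpMap A B) : Prop :=
  (∀ j, IsCPTN (M j)) ∧ IsCPTP (∑ j, M j)

/-- A signed sum `∑ j, s j • M j`, with signs `s j = ±1`, of the members of an instrument. -/
def IsTwistedChannel (T : OpMap A B) : Prop :=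
  ∃ (n : ℕ) (s : Fin n → ℝ) (M : Fin n → OpMap A B),
    (∀ j, s j = 1 ∨ s j = -1) ∧ IsQuantumInstrument M ∧ T = ∑ j, s j • M j

/-- A density operator. -/
def IsState (ρ : Matrix A A ℂ) : Prop :=
  ρ.PosSemidef ∧ ρ.trace = 1

/-- The trace norm `Tr √(Xᴴ X)`: the sum of the singular values of `X`. -/
noncomputable def traceNorm [DecidableEq A] (X : Matrix A A ℂ) : ℝ :=
  ∑ i, √((Matrix.isHermitian_conjTranspose_mul_self X).eigenvalues i)

/-- The values `‖(id ⊗ E)(ρ)‖₁` over all states `ρ` of `A' ⊗ A`, with `A'` a copy of `A`. -/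
def diamondValues [DecidableEq A] [DecidableEq B] (E : OpMap A B) : Set ℝ :=
  {r | ∃ ρ : Matrix (A × A) (A × A) ℂ, IsState ρ ∧ r = traceNorm (idTensor A E ρ)}

/-- The diamond norm of a Hermitian-preserving map. -/
noncomputable def diamondNorm [DecidableEq A] [DecidableEq B] (E : OpMap A B) : ℝ :=
  sSup (diamondValues E)

/-- The `t ≥ 0` such that mixing `E` with some twisted channel, with weight `t` relative to `E`,
gives a twisted channel. -/
def robustnessSet (E : OpMap A B) : Set ℝ :=
  {t | 0 ≤ t ∧ ∃ T : OpMap A B, IsTwistedChannel T ∧ IsTwistedChannel ((1 + t)⁻¹ • (E + t • T))}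

/-- The absolute robustness with respect to twisted channels. -/
noncomputable def absoluteRobustness (E : OpMap A B) : ℝ :=
  sInf (robustnessSet E)

end QuantumMap

/-! ### Positive semidefinite matrices and contractions: trace pairings and compactness. -/

namespace Matrix

variable {n : Type*} [Fintype n]

/-! The heart is that twisted channels are exactly the Hermitian-preserving maps of diamond norm at
most one. A twisted channel meets this bound because a contraction `K` paired with each signed term
gives at most the trace of that term, and the traces add up to one
(`IsTwistedChannel.re_trace_mul_idTensor_le`). Conversely, `E` is twisted as soon as its Choi
operator `J` equals `P - Q` with `P, Q ≥ 0` and `Tr_B (P + Q) = 1`. If no such pair exists,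
separation from a closed cone gives `-Y ⊗ 1 ≤ H ≤ Y ⊗ 1` with `Tr Y < Tr (H J)`. With `Y` perturbed
to an invertible `Sᴴ S`, conjugating by `S ⊗ 1` turns `H` into a contraction and `S` into a pure
state, which together witness a diamond norm above one (`re_trace_mul_choi_le`). Now let `d` be the
diamond norm. The triangle inequality for `E = (1 + t) S - t T` gives `d ≤ 1 + 2 t`. For `d ≥ 1`
equality is reached by mixing with `-E / d`, which yields `E / d`. -/

open scoped MatrixOrder in
theorem PosSemidef.exists_eq_conjTranspose_mul_self {M : Matrix n n ℂ} (h : M.PosSemidef) :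
    ∃ B : Matrix n n ℂ, M = Bᴴ * B := by
  classical
  exact CStarAlgebra.nonneg_iff_eq_star_mul_self.mp h.nonneg

/-- In `M = Bᴴ B` an entry is an inner product of two columns of `B`, and the trace is the sum of
all squared column norms. This makes trace-bounded sets of positive matrices compact. -/
theorem PosSemidef.norm_apply_le {M : Matrix n n ℂ} (h : M.PosSemidef) (i j : n) :
    ‖M i j‖ ≤ M.trace.re := by
  obtain ⟨B, rfl⟩ := h.exists_eq_conjTranspose_mul_self
  have key (l : n) : ∑ k, ‖B k l‖ ^ 2 ≤ (Bᴴ * B).trace.re := by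
    have : (Bᴴ * B).trace.re = ∑ l, ∑ k, ‖B k l‖ ^ 2 := by
      simp [trace, mul_apply, ← Complex.normSq_eq_norm_sq, Complex.normSq_apply]
    rw [this]
    exact Finset.single_le_sum (f := fun l => ∑ k, ‖B k l‖ ^ 2)
      (fun _ _ => Finset.sum_nonneg fun _ _ => by positivity) (Finset.mem_univ l)
  calc ‖(Bᴴ * B) i j‖ ≤ ∑ k, ‖B k i‖ * ‖B k j‖ := by
        rw [mul_apply]
        refine (norm_sum_le _ _).trans (le_of_eq ?_)
        simp
    _ ≤ ∑ k, (‖B k i‖ ^ 2 + ‖B k j‖ ^ 2) / 2 :=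
        Finset.sum_le_sum fun k _ => by nlinarith [sq_nonneg (‖B k i‖ - ‖B k j‖)]
    _ = (∑ k, ‖B k i‖ ^ 2 + ∑ k, ‖B k j‖ ^ 2) / 2 := by
        rw [← Finset.sum_div, Finset.sum_add_distrib]
    _ ≤ (Bᴴ * B).trace.re := by linarith [key i, key j]

theorem isClosed_setOf_posSemidef : IsClosed {M : Matrix n n ℂ | M.PosSemidef} := by
  have : {M : Matrix n n ℂ | M.PosSemidef} =
      {M | Mᴴ = M} ∩ ⋂ x : n → ℂ, {M | 0 ≤ star x ⬝ᵥ M *ᵥ x} := by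
    ext M
    simp [posSemidef_iff_dotProduct_mulVec, IsHermitian]
  rw [this]
  refine (isClosed_eq (by fun_prop) (by fun_prop)).inter (isClosed_iInter fun x => ?_)
  exact isClosed_le continuous_const (by fun_prop)

theorem isCompact_setOf_posSemidef_trace_le (r : ℝ) :
    IsCompact {M : Matrix n n ℂ | M.PosSemidef ∧ M.trace.re ≤ r} := by
  have hK : IsCompact (Set.univ.pi fun _ : n => Set.univ.pi fun _ : n =>
      Metric.closedBall (0 : ℂ) r) :=
    isCompact_univ_pi fun _ => isCompact_univ_pi fun _ => isCompact_closedBall 0 r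
  refine IsCompact.of_isClosed_subset hK ?_ ?_
  · exact isClosed_setOf_posSemidef.inter
      (isClosed_le (f := fun M : Matrix n n ℂ => M.trace.re)
        (Complex.continuous_re.comp (continuous_id.matrix_trace)) continuous_const)
  · rintro M ⟨hM, ht⟩ i - j -
    exact mem_closedBall_zero_iff.2 ((hM.norm_apply_le i j).trans ht)

theorem PosSemidef.re_trace_nonneg {M : Matrix n n ℂ} (h : M.PosSemidef) : 0 ≤ M.trace.re :=
  (Complex.le_def.1 h.trace_nonneg).1

theorem PosSemidef.re_trace_mul_nonneg {P Q : Matrix n n ℂ} (hP : P.PosSemidef)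
    (hQ : Q.PosSemidef) : 0 ≤ (P * Q).trace.re := by
  obtain ⟨B, rfl⟩ := hQ.exists_eq_conjTranspose_mul_self
  rw [← Matrix.mul_assoc, trace_mul_comm, ← Matrix.mul_assoc]
  exact (hP.mul_mul_conjTranspose_same B).re_trace_nonneg

/-- Self-duality of the positive cone; rank-one tests suffice. -/
theorem IsHermitian.posSemidef_of_re_trace_mul_nonneg {M : Matrix n n ℂ} (hM : M.IsHermitian)
    (h : ∀ P : Matrix n n ℂ, P.PosSemidef → 0 ≤ (M * P).trace.re) : M.PosSemidef := by
  refine .of_dotProduct_mulVec_nonneg hM fun x => ?_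
  rw [Complex.le_def]
  refine ⟨?_, (hM.im_star_dotProduct_mulVec_self x).symm⟩
  have := h _ (posSemidef_vecMulVec_self_star x)
  rwa [mul_vecMulVec, trace_vecMulVec, dotProduct_comm] at this

/-- Self-adjoint operators of operator norm at most one, i.e. `-1 ≤ K ≤ 1`. -/
def IsContraction [DecidableEq n] (K : Matrix n n ℂ) : Prop :=
  (1 - K).PosSemidef ∧ (1 + K).PosSemidef

section

variable [DecidableEq n]

omit [Fintype n] in
theorem IsContraction.neg {K : Matrix n n ℂ} (h : K.IsContraction) : (-K).IsContraction :=
  ⟨by simpa using h.2, by simpa [sub_eq_add_neg] using h.1⟩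

theorem isCompact_setOf_isContraction : IsCompact {K : Matrix n n ℂ | K.IsContraction} := by
  -- `1 + K ≥ 0` gives `Tr K ≥ -Tr 1`, so the positive matrix `1 - K` has trace at most `2 Tr 1`.
  refine IsCompact.of_isClosed_subset (((isCompact_setOf_posSemidef_trace_le (n := n)
    (2 * (1 : Matrix n n ℂ).trace.re)).image (f := fun M => 1 - M) (by fun_prop))) ?_ ?_
  · exact (isClosed_setOf_posSemidef.preimage (by fun_prop)).inter
      (isClosed_setOf_posSemidef.preimage (by fun_prop))
  · rintro K ⟨h1, h2⟩
    refine ⟨1 - K, ⟨h1, ?_⟩, by simp⟩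
    have := h2.re_trace_nonneg
    simp only [trace_add, trace_sub, Complex.add_re, Complex.sub_re] at this ⊢
    linarith

theorem IsContraction.re_trace_mul_le {K P : Matrix n n ℂ} (hK : K.IsContraction)
    (hP : P.PosSemidef) : (K * P).trace.re ≤ P.trace.re := by
  have := hK.1.re_trace_mul_nonneg hP
  simp only [Matrix.sub_mul, Matrix.one_mul, trace_sub, Complex.sub_re] at this
  linarith

end

end Matrix

/-! ### Trace norm as a maximum over contractions. -/

namespace QuantumMap

open Matrix

variable {n : Type*} [Fintype n] [DecidableEq n]

/-- The eigenvalues in `traceNorm` come with their own ordering, so they are matched with `d i ^ 2`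
as multisets of roots of the characteristic polynomial of `Xᴴ X`. -/
theorem traceNorm_eq_sum_abs {X U : Matrix n n ℂ} {d : n → ℝ} (hU : Uᴴ * U = 1)
    (hX : X = U * diagonal (fun i => (d i : ℂ)) * Uᴴ) : traceNorm X = ∑ i, |d i| := by
  have hY := isHermitian_conjTranspose_mul_self X
  have hXX : Xᴴ * X = U * diagonal (fun i => ((d i ^ 2 : ℝ) : ℂ)) * Uᴴ := by
    have hXh : Xᴴ = U * diagonal (fun i => (d i : ℂ)) * Uᴴ := by
      simp only [hX, conjTranspose_mul, conjTranspose_conjTranspose, diagonal_conjTranspose,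
        Matrix.mul_assoc]
      congr 3
      ext i
      simp
    calc Xᴴ * X = U * diagonal (fun i => (d i : ℂ)) * (Uᴴ * U) *
          diagonal (fun i => (d i : ℂ)) * Uᴴ := by rw [hXh, hX]; simp only [Matrix.mul_assoc]
      _ = _ := by
        rw [hU, Matrix.mul_one, Matrix.mul_assoc U, diagonal_mul_diagonal]
        simp only [sq, Complex.ofReal_mul]
  have hroots : (Xᴴ * X).charpoly.roots =
      Multiset.map (fun i => ((d i ^ 2 : ℝ) : ℂ)) Finset.univ.val := by
    rw [hXX, charpoly_mul_comm, ← Matrix.mul_assoc, hU, Matrix.one_mul, charpoly_diagonal,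
      Polynomial.roots_prod]
    · simp only [Polynomial.roots_X_sub_C, Multiset.bind_singleton]
    · exact Finset.prod_ne_zero_iff.2 fun i _ => Polynomial.X_sub_C_ne_zero _
  rw [hY.roots_charpoly_eq_eigenvalues] at hroots
  have h := congrArg (fun s => (s.map fun z : ℂ => √z.re).sum) hroots
  simp only [Multiset.map_map, Function.comp_def, RCLike.ofReal_eq_complex_ofReal,
    Complex.ofReal_re, Real.sqrt_sq_eq_abs] at h
  exact h

theorem exists_unitary_diagonalization {X : Matrix n n ℂ} (hX : X.IsHermitian) :
    ∃ (U : Matrix n n ℂ) (d : n → ℝ), Uᴴ * U = 1 ∧ U * Uᴴ = 1 ∧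
      X = U * diagonal (fun i => (d i : ℂ)) * Uᴴ :=
  ⟨hX.eigenvectorUnitary, hX.eigenvalues, Unitary.coe_star_mul_self hX.eigenvectorUnitary,
    Unitary.coe_mul_star_self hX.eigenvectorUnitary, hX.spectral_theorem⟩

theorem posSemidef_conj_diagonal (U : Matrix n n ℂ) {d : n → ℝ} (hd : ∀ i, 0 ≤ d i) :
    (U * diagonal (fun i => (d i : ℂ)) * Uᴴ).PosSemidef :=
  (PosSemidef.diagonal fun i => Complex.zero_le_real.2 (hd i)).mul_mul_conjTranspose_same U

theorem trace_conj_diagonal {U : Matrix n n ℂ} (hU : Uᴴ * U = 1) (d : n → ℝ) :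
    (U * diagonal (fun i => (d i : ℂ)) * Uᴴ).trace.re = ∑ i, d i := by
  rw [trace_mul_comm, ← Matrix.mul_assoc, hU, Matrix.one_mul, trace_diagonal]
  simp

/-- Split `X` into positive and negative parts; pair the first with `K` and the second with `-K`. -/
theorem re_trace_mul_le_traceNorm {X K : Matrix n n ℂ} (hX : X.IsHermitian)
    (hK : K.IsContraction) : (K * X).trace.re ≤ traceNorm X := by
  obtain ⟨U, d, hU, -, rfl⟩ := exists_unitary_diagonalization hX
  rw [traceNorm_eq_sum_abs hU rfl]
  have hd : U * diagonal (fun i => (d i : ℂ)) * Uᴴ =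
      U * diagonal (fun i => ((d i)⁺ : ℝ) : n → ℂ) * Uᴴ -
        U * diagonal (fun i => ((d i)⁻ : ℝ) : n → ℂ) * Uᴴ := by
    rw [← Matrix.sub_mul, ← Matrix.mul_sub, diagonal_sub]
    simp only [← Complex.ofReal_sub, posPart_sub_negPart]
  have h1 := hK.re_trace_mul_le (posSemidef_conj_diagonal U fun i => posPart_nonneg (d i))
  have h2 := hK.neg.re_trace_mul_le (posSemidef_conj_diagonal U fun i => negPart_nonneg (d i))
  rw [trace_conj_diagonal hU] at h1 h2
  rw [Matrix.neg_mul, trace_neg, Complex.neg_re] at h2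
  simp only [← posPart_add_negPart, Finset.sum_add_distrib]
  rw [hd, Matrix.mul_sub, trace_sub, Complex.sub_re]
  linarith

theorem exists_isContraction_traceNorm_eq {X : Matrix n n ℂ} (hX : X.IsHermitian) :
    ∃ K : Matrix n n ℂ, K.IsContraction ∧ traceNorm X = (K * X).trace.re := by
  obtain ⟨U, d, hU, hU', rfl⟩ := exists_unitary_diagonalization hX
  -- The maximizer is the sign of `X`; its value on the kernel of `X` does not affect the trace.
  let s : n → ℝ := fun i => if 0 ≤ d i then 1 else -1
  refine ⟨U * diagonal (fun i => (s i : ℂ)) * Uᴴ, ⟨?_, ?_⟩, ?_⟩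
  · have h : 1 - U * diagonal (fun i => (s i : ℂ)) * Uᴴ =
        U * diagonal (fun i => ((1 - s i : ℝ) : ℂ)) * Uᴴ := by
      simp only [Complex.ofReal_sub, ← diagonal_sub, Matrix.mul_sub, Matrix.sub_mul,
        Complex.ofReal_one, diagonal_one, Matrix.mul_one, hU']
    rw [h]
    exact posSemidef_conj_diagonal U fun i => by dsimp only [s]; split_ifs <;> norm_num
  · have h : 1 + U * diagonal (fun i => (s i : ℂ)) * Uᴴ =
        U * diagonal (fun i => ((1 + s i : ℝ) : ℂ)) * Uᴴ := by
      simp only [Complex.ofReal_add, ← diagonal_add, Matrix.mul_add, Matrix.add_mul,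
        Complex.ofReal_one, diagonal_one, Matrix.mul_one, hU']
    rw [h]
    exact posSemidef_conj_diagonal U fun i => by dsimp only [s]; split_ifs <;> norm_num
  · have h : U * diagonal (fun i => (s i : ℂ)) * Uᴴ * (U * diagonal (fun i => (d i : ℂ)) * Uᴴ) =
        U * diagonal (fun i => ((|d i| : ℝ) : ℂ)) * Uᴴ := by
      calc _ = U * diagonal (fun i => (s i : ℂ)) * (Uᴴ * U) *
            diagonal (fun i => (d i : ℂ)) * Uᴴ := by simp only [Matrix.mul_assoc]
        _ = _ := by
          rw [hU, Matrix.mul_one, Matrix.mul_assoc U, diagonal_mul_diagonal]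
          congr! 4 with i
          rw [← Complex.ofReal_mul]
          dsimp only [s]
          split_ifs with hi
          · rw [abs_of_nonneg hi, one_mul]
          · rw [abs_of_neg (not_le.1 hi), neg_one_mul]
    rw [h, trace_conj_diagonal hU, traceNorm_eq_sum_abs hU rfl]

end QuantumMap

/-! ### Maps on composite systems and attainment of the diamond norm. -/

namespace QuantumMap

open Matrix

section idTensor

variable {A B C : Type*}

theorem idTensor_apply (E : OpMap A B) (X : Matrix (C × A) (C × A) ℂ) (p q : C × B) :
    idTensor C E X p q = E (Matrix.of fun a a' => X (p.1, a) (q.1, a')) p.2 q.2 := rfl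

theorem idTensor_add (E F : OpMap A B) : idTensor C (E + F) = idTensor C E + idTensor C F := by
  ext1 X
  rfl

theorem idTensor_smul (t : ℝ) (E : OpMap A B) : idTensor C (t • E) = t • idTensor C E := by
  ext1 X
  rfl

theorem idTensor_sum {ι : Type*} (s : Finset ι) (M : ι → OpMap A B) :
    idTensor C (∑ j ∈ s, M j) = ∑ j ∈ s, idTensor C (M j) := by
  classical
  induction s using Finset.induction_on with
  | empty => ext1 X; rfl
  | insert j s hj ih => rw [Finset.sum_insert hj, Finset.sum_insert hj, idTensor_add, ih]

theorem idTensor_submatrix {D : Type*} (f : D → C) (E : OpMap A B)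
    (X : Matrix (C × A) (C × A) ℂ) :
    idTensor D E (X.submatrix (Prod.map f id) (Prod.map f id)) =
      (idTensor C E X).submatrix (Prod.map f id) (Prod.map f id) := rfl

theorem IsHermitianPreserving.map_conjTranspose {E : OpMap A B} (hE : IsHermitianPreserving E)
    (X : Matrix A A ℂ) : E Xᴴ = (E X)ᴴ := by
  obtain ⟨Y, Z, hY, hZ, hX, hX'⟩ : ∃ Y Z : Matrix A A ℂ, Y.IsHermitian ∧ Z.IsHermitian ∧
      X = Y + Complex.I • Z ∧ Xᴴ = Y - Complex.I • Z := by
    refine ⟨(1 / 2 : ℂ) • (X + Xᴴ), (-Complex.I / 2) • (X - Xᴴ), ?_, ?_, ?_, ?_⟩ <;> ext i j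
    · simp [add_comm]
      ring
    · simp
      ring
    · simp
      linear_combination (1 / 2 * (X i j - starRingEnd ℂ (X j i))) * Complex.I_sq
    · simp
      linear_combination (-(1 / 2) * (X i j - starRingEnd ℂ (X j i))) * Complex.I_sq
  have h1 := (hE Y hY).eq
  have h2 := (hE Z hZ).eq
  rw [hX', hX, map_sub, map_add, map_smul, conjTranspose_add, conjTranspose_smul, h1, h2]
  simp [sub_eq_add_neg]

theorem IsHermitianPreserving.isHermitian_idTensor {E : OpMap A B}
    (hE : IsHermitianPreserving E) {X : Matrix (C × A) (C × A) ℂ} (hX : X.IsHermitian) :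
    (idTensor C E X).IsHermitian := by
  ext p q : 2
  rw [conjTranspose_apply, idTensor_apply, idTensor_apply, ← conjTranspose_apply,
    ← hE.map_conjTranspose]
  have h : (Matrix.of fun a a' => X (q.1, a) (p.1, a'))ᴴ =
      Matrix.of fun a a' => X (p.1, a) (q.1, a') := by
    ext a a'
    exact congrFun (congrFun hX.eq _) _
  rw [h]

theorem IsHermitianPreserving.smul {E : OpMap A B} (hE : IsHermitianPreserving E) (t : ℝ) :
    IsHermitianPreserving (t • E) := fun X hX => by
  have := (hE X hX).eq
  rw [LinearMap.smul_apply, IsHermitian, conjTranspose_smul, this, star_trivial]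

/-- Complete positivity is defined with references `Fin n` only; reindexing covers any finite `C`.
-/
theorem IsCompletelyPositive.posSemidef_idTensor [Fintype C] {E : OpMap A B}
    (hE : IsCompletelyPositive E) {X : Matrix (C × A) (C × A) ℂ} (hX : X.PosSemidef) :
    (idTensor C E X).PosSemidef := by
  let e := Fintype.equivFin C
  have h := hE _ _ (hX.submatrix (Prod.map e.symm id))
  rw [idTensor_submatrix] at h
  have h' := h.submatrix (Prod.map e id)
  rw [submatrix_submatrix] at h'
  convert h'
  ext p q
  simp [Prod.map]

variable [Fintype A] [Fintype B] [Fintype C]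

theorem IsTracePreserving.trace_idTensor {E : OpMap A B} (hE : IsTracePreserving E)
    (X : Matrix (C × A) (C × A) ℂ) : (idTensor C E X).trace = X.trace := by
  simp only [trace, Fintype.sum_prod_type, diag_apply]
  exact Finset.sum_congr rfl fun c _ => hE (Matrix.of fun a a' => X (c, a) (c, a'))

theorem IsTwistedChannel.re_trace_mul_idTensor_le [DecidableEq B] [DecidableEq C] {T : OpMap A B}
    (hT : IsTwistedChannel T) {ρ : Matrix (C × A) (C × A) ℂ} (hρ : ρ.PosSemidef)
    {K : Matrix (C × B) (C × B) ℂ} (hK : K.IsContraction) :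
    (K * idTensor C T ρ).trace.re ≤ ρ.trace.re := by
  obtain ⟨n, s, M, hs, ⟨hM, hM'⟩, rfl⟩ := hT
  rw [← hM'.2.trace_idTensor ρ, idTensor_sum, idTensor_sum]
  simp only [idTensor_smul, LinearMap.sum_apply, LinearMap.smul_apply, Finset.mul_sum,
    trace_sum, Complex.re_sum]
  refine Finset.sum_le_sum fun j _ => ?_
  have hP := (hM j).1.posSemidef_idTensor hρ
  rcases hs j with h | h
  · simpa [h] using hK.re_trace_mul_le hP
  · simpa [h] using hK.neg.re_trace_mul_le hP

theorem exists_isState [Nonempty A] : ∃ ρ : Matrix A A ℂ, IsState ρ := by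
  classical
  obtain ⟨a⟩ := ‹Nonempty A›
  refine ⟨vecMulVec (Pi.single a 1) (star (Pi.single a 1)), posSemidef_vecMulVec_self_star _, ?_⟩
  rw [trace_vecMulVec]
  simp

theorem isCompact_setOf_isState : IsCompact {ρ : Matrix A A ℂ | IsState ρ} := by
  refine (isCompact_setOf_posSemidef_trace_le (n := A) 1).of_isClosed_subset ?_ ?_
  · exact isClosed_setOf_posSemidef.inter
      (isClosed_eq (f := fun M : Matrix A A ℂ => M.trace) continuous_id.matrix_trace
        continuous_const)
  · rintro ρ ⟨h1, h2⟩
    exact ⟨h1, by rw [h2, Complex.one_re]⟩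

/-- Maximizing jointly over states and contractions makes the objective visibly continuous on a
compact set, so continuity of the trace norm is never needed. -/
theorem exists_isGreatest_diamondValues [DecidableEq A] [DecidableEq B] [Nonempty A]
    {E : OpMap A B} (hE : IsHermitianPreserving E) : ∃ d, IsGreatest (diamondValues E) d := by
  obtain ⟨σ, hσ⟩ := exists_isState (A := A × A)
  have hne : ({ρ : Matrix (A × A) (A × A) ℂ | IsState ρ} ×ˢ
      {K : Matrix (A × B) (A × B) ℂ | K.IsContraction}).Nonempty :=
    ⟨(σ, 0), hσ, by simpa using PosSemidef.one, by simpa using PosSemidef.one⟩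
  have hcont : Continuous fun p : Matrix (A × A) (A × A) ℂ × Matrix (A × B) (A × B) ℂ =>
      (p.2 * idTensor A E p.1).trace.re := by
    have : Continuous (idTensor A E) := LinearMap.continuous_of_finiteDimensional _
    exact Complex.continuous_re.comp
      ((continuous_snd.matrix_mul (this.comp continuous_fst)).matrix_trace)
  obtain ⟨⟨ρ, K⟩, ⟨hρ, hK⟩, hmax⟩ := (isCompact_setOf_isState.prod
    isCompact_setOf_isContraction).exists_isMaxOn hne hcont.continuousOn
  refine ⟨traceNorm (idTensor A E ρ), ⟨ρ, hρ, rfl⟩, ?_⟩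
  rintro _ ⟨τ, hτ, rfl⟩
  obtain ⟨L, hL, h⟩ := exists_isContraction_traceNorm_eq (hE.isHermitian_idTensor hτ.1.1)
  rw [h]
  exact (hmax (show (τ, L) ∈ _ from ⟨hτ, hL⟩)).trans
    (re_trace_mul_le_traceNorm (hE.isHermitian_idTensor hρ.1.1) hK)

end idTensor

/-! ### Choi operators, partial trace and pure states. -/

section Choi

variable {A B C : Type*} [Fintype A] [Fintype B]

/-- The map whose Choi operator is `P`. -/
def ofChoi (P : Matrix (A × B) (A × B) ℂ) : OpMap A B where
  toFun X := Matrix.of fun b b' => ∑ a, ∑ a', X a a' * P (a, b) (a', b')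
  map_add' X Y := by
    ext b b'
    simp [add_mul, Finset.sum_add_distrib]
  map_smul' c X := by
    ext b b'
    simp [Finset.mul_sum, mul_assoc]

omit [Fintype B] in
theorem ofChoi_apply (P : Matrix (A × B) (A × B) ℂ) (X : Matrix A A ℂ) (b b' : B) :
    ofChoi P X b b' = ∑ a, ∑ a', X a a' * P (a, b) (a', b') := rfl

theorem posSemidef_idTensor_ofChoi [Fintype C] {P : Matrix (A × B) (A × B) ℂ}
    (hP : P.PosSemidef) {X : Matrix (C × A) (C × A) ℂ} (hX : X.PosSemidef) :
    (idTensor C (ofChoi P) X).PosSemidef := by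
  classical
  obtain ⟨S, rfl⟩ := hP.exists_eq_conjTranspose_mul_self
  -- Each row of `S` is a Kraus operator; `W k` is its tensor product with the identity on `C`.
  let W (k : A × B) : Matrix (C × B) (C × A) ℂ :=
    Matrix.of fun p q => if p.1 = q.1 then star (S k (q.2, p.2)) else 0
  have h : idTensor C (ofChoi (Sᴴ * S)) X = ∑ k, W k * X * (W k)ᴴ := by
    ext ⟨c, b⟩ ⟨c', b'⟩
    rw [idTensor_apply, ofChoi_apply, Matrix.sum_apply]
    have hk (k : A × B) : (W k * X * (W k)ᴴ) (c, b) (c', b') =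
        ∑ a', ∑ a, star (S k (a, b)) * X (c, a) (c', a') * S k (a', b') := by
      simp [W, mul_apply, Fintype.sum_prod_type_right (α₁ := C), Finset.sum_mul, apply_ite star]
    simp only [hk, mul_apply (M := Sᴴ), conjTranspose_apply, Finset.mul_sum]
    rw [Finset.sum_comm (s := Finset.univ (α := A × B)), Finset.sum_comm]
    refine Finset.sum_congr rfl fun a' _ => ?_
    rw [Finset.sum_comm (s := Finset.univ (α := A × B))]
    exact Finset.sum_congr rfl fun a _ => Finset.sum_congr rfl fun k _ => by
      simp only [of_apply]
      ring
  rw [h]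
  exact posSemidef_sum _ fun k _ => hX.mul_mul_conjTranspose_same (W k)

theorem isCompletelyPositive_ofChoi {P : Matrix (A × B) (A × B) ℂ} (hP : P.PosSemidef) :
    IsCompletelyPositive (ofChoi P) := fun _ _ hX => posSemidef_idTensor_ofChoi hP hX

theorem IsCompletelyPositive.posSemidef_apply {A B : Type*} {E : OpMap A B}
    (hE : IsCompletelyPositive E) {X : Matrix A A ℂ} (hX : X.PosSemidef) : (E X).PosSemidef :=
  (hE.posSemidef_idTensor (C := Unit) (hX.submatrix Prod.snd)).submatrix fun b => ((), b)

/-- The partial trace over the second factor. -/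
def partialTrace : Matrix (A × B) (A × B) ℂ →ₗ[ℂ] Matrix A A ℂ where
  toFun P := Matrix.of fun a a' => ∑ b, P (a, b) (a', b)
  map_add' X Y := by
    ext b b'
    simp [Finset.sum_add_distrib]
  map_smul' c X := by
    ext b b'
    simp [Finset.mul_sum]

omit [Fintype A] in
theorem partialTrace_apply (P : Matrix (A × B) (A × B) ℂ) (a a' : A) :
    partialTrace P a a' = ∑ b, P (a, b) (a', b) := rfl

theorem trace_partialTrace (P : Matrix (A × B) (A × B) ℂ) :
    (partialTrace P).trace = P.trace := by
  simp [trace, partialTrace_apply, Fintype.sum_prod_type]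

theorem trace_mul_partialTrace [DecidableEq B] (Y : Matrix A A ℂ) (P : Matrix (A × B) (A × B) ℂ) :
    (Y * partialTrace P).trace = ((Y ⊗ₖ (1 : Matrix B B ℂ)) * P).trace := by
  simp only [trace, diag_apply, mul_apply, partialTrace_apply, Fintype.sum_prod_type,
    kroneckerMap_apply, one_apply, mul_ite, mul_one, mul_zero, ite_mul, zero_mul,
    Finset.sum_ite_eq, Finset.mem_univ, if_true, Finset.mul_sum]
  exact Finset.sum_congr rfl fun _ _ => Finset.sum_comm

theorem trace_ofChoi_apply (P : Matrix (A × B) (A × B) ℂ) (X : Matrix A A ℂ) :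
    (ofChoi P X).trace = ∑ a, ∑ a', X a a' * partialTrace P a a' := by
  simp only [trace, diag_apply, ofChoi_apply, partialTrace_apply, Finset.mul_sum]
  rw [Finset.sum_comm]
  exact Finset.sum_congr rfl fun _ _ => Finset.sum_comm

omit [Fintype B] in
theorem ofChoi_add (P Q : Matrix (A × B) (A × B) ℂ) : ofChoi (P + Q) = ofChoi P + ofChoi Q := by
  ext X b b'
  simp [ofChoi_apply, mul_add, Finset.sum_add_distrib]

omit [Fintype B] in
theorem ofChoi_sub (P Q : Matrix (A × B) (A × B) ℂ) : ofChoi (P - Q) = ofChoi P - ofChoi Q := by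
  ext X b b'
  simp [ofChoi_apply, mul_sub, Finset.sum_sub_distrib]

/-- A two-outcome instrument with signs `+1` and `-1`. Each branch is trace-nonincreasing because
the other has nonnegative trace on positive inputs. -/
theorem isTwistedChannel_ofChoi_sub [DecidableEq A] {P Q : Matrix (A × B) (A × B) ℂ}
    (hP : P.PosSemidef) (hQ : Q.PosSemidef) (h : partialTrace (P + Q) = 1) :
    IsTwistedChannel (ofChoi (P - Q)) := by
  have htp : IsTracePreserving (ofChoi (P + Q)) := fun X => by
    rw [trace_ofChoi_apply, h]
    simp [trace, one_apply]
  have htn (X : Matrix A A ℂ) : (ofChoi P X).trace.re + (ofChoi Q X).trace.re = X.trace.re := by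
    rw [← htp X, ofChoi_add, LinearMap.add_apply, trace_add, Complex.add_re]
  have hPc := isCompletelyPositive_ofChoi hP
  have hQc := isCompletelyPositive_ofChoi hQ
  refine ⟨2, ![1, -1], ![ofChoi P, ofChoi Q], ?_, ⟨?_, ?_⟩, ?_⟩
  · simp [Fin.forall_fin_two]
  · simp only [Fin.forall_fin_two, cons_val_zero, cons_val_one]
    exact ⟨⟨hPc, fun X hX => by linarith [htn X, (hQc.posSemidef_apply hX).re_trace_nonneg]⟩,
      hQc, fun X hX => by linarith [htn X, (hPc.posSemidef_apply hX).re_trace_nonneg]⟩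
  · rw [Fin.sum_univ_two, cons_val_zero, cons_val_one, cons_val_zero, ← ofChoi_add]
    exact ⟨isCompletelyPositive_ofChoi (hP.add hQ), htp⟩
  · rw [ofChoi_sub]
    ext X b b'
    simp [Fin.sum_univ_two, sub_eq_add_neg]

variable [DecidableEq A]

/-- The Choi operator `(id ⊗ E)(Ω)`, with `Ω` the unnormalized maximally entangled operator. -/
def choi (E : OpMap A B) : Matrix (A × B) (A × B) ℂ :=
  Matrix.of fun p q => E (single p.1 q.1 1) p.2 q.2

omit [Fintype A] [Fintype B] in
theorem choi_apply (E : OpMap A B) (p q : A × B) :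
    choi E p q = E (single p.1 q.1 1) p.2 q.2 := rfl

omit [Fintype B] in
theorem apply_eq_sum_choi (E : OpMap A B) (X : Matrix A A ℂ) (b b' : B) :
    E X b b' = ∑ a, ∑ a', X a a' * choi E (a, b) (a', b') := by
  conv_lhs => rw [matrix_eq_sum_single X]
  simp only [map_sum, Matrix.sum_apply, choi_apply]
  refine Finset.sum_congr rfl fun a _ => Finset.sum_congr rfl fun a' _ => ?_
  have h : single a a' (X a a') = X a a' • single a a' 1 := by rw [smul_single, smul_eq_mul, mul_one]
  rw [h, map_smul, Matrix.smul_apply, smul_eq_mul]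

omit [Fintype B] in
theorem ofChoi_choi (E : OpMap A B) : ofChoi (choi E) = E := by
  ext X b b'
  rw [ofChoi_apply, apply_eq_sum_choi]

omit [Fintype A] [Fintype B] in
theorem IsHermitianPreserving.isHermitian_choi {E : OpMap A B} (hE : IsHermitianPreserving E) :
    (choi E).IsHermitian := by
  ext p q
  rw [conjTranspose_apply, choi_apply, choi_apply, ← conjTranspose_apply,
    ← hE.map_conjTranspose]
  simp

/-- The unnormalized pure state with vector `(S ⊗ 1) ∑ a, |a a⟩`. -/
def pureOf (S : Matrix A A ℂ) : Matrix (A × A) (A × A) ℂ :=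
  vecMulVec (fun p => S p.1 p.2) (star fun p => S p.1 p.2)

omit [DecidableEq A] in
theorem posSemidef_pureOf (S : Matrix A A ℂ) : (pureOf S).PosSemidef :=
  posSemidef_vecMulVec_self_star _

omit [DecidableEq A] in
theorem trace_pureOf (S : Matrix A A ℂ) : (pureOf S).trace = (Sᴴ * S).trace := by
  rw [pureOf, trace_vecMulVec, trace_mul_comm]
  simp [trace, mul_apply, dotProduct, Fintype.sum_prod_type]

/-- `S` acts on the reference alone, so it commutes past `id ⊗ E`. -/
theorem idTensor_pureOf [DecidableEq B] (S : Matrix A A ℂ) (E : OpMap A B) :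
    idTensor A E (pureOf S) =
      (S ⊗ₖ (1 : Matrix B B ℂ)) * choi E * (S ⊗ₖ (1 : Matrix B B ℂ))ᴴ := by
  ext ⟨c, b⟩ ⟨c', b'⟩
  rw [idTensor_apply, apply_eq_sum_choi]
  simp only [mul_apply, conjTranspose_apply, Fintype.sum_prod_type, kroneckerMap_apply, one_apply,
    mul_ite, mul_one, mul_zero, ite_mul, zero_mul, apply_ite star, star_zero, Finset.sum_ite_eq,
    Finset.mem_univ, if_true, of_apply, pureOf, vecMulVec_apply, Pi.star_apply, Finset.sum_mul]
  rw [Finset.sum_comm]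
  exact Finset.sum_congr rfl fun _ _ => Finset.sum_congr rfl fun _ _ => by ring

end Choi

end QuantumMap

/-! ### Conic duality for the decomposition `J = P - Q`. -/

namespace QuantumMap

open Matrix

theorem exists_forall_eq_trace_mul {n : Type*} [Fintype n] (g : Matrix n n ℂ →ₗ[ℂ] ℂ) :
    ∃ G : Matrix n n ℂ, ∀ X, g X = (G * X).trace := by
  classical
  refine ⟨Matrix.of fun j i => g (single i j 1), fun X => ?_⟩
  conv_lhs => rw [matrix_eq_sum_single X]
  simp only [map_sum, trace, diag_apply, mul_apply, of_apply]
  rw [Finset.sum_comm]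
  refine Finset.sum_congr rfl fun a _ => Finset.sum_congr rfl fun b _ => ?_
  have h : single b a (X b a) = X b a • single b a 1 := by rw [smul_single, smul_eq_mul, mul_one]
  rw [h, map_smul, smul_eq_mul, mul_comm]

theorem exists_isHermitian_forall_re_eq_trace_mul {n : Type*} [Fintype n]
    (g : Matrix n n ℂ →ₗ[ℂ] ℂ) : ∃ H : Matrix n n ℂ, H.IsHermitian ∧
      ∀ X : Matrix n n ℂ, X.IsHermitian → (g X).re = (H * X).trace.re := by
  obtain ⟨G, hG⟩ := exists_forall_eq_trace_mul g
  refine ⟨(1 / 2 : ℝ) • (G + Gᴴ), ?_, fun X hX => ?_⟩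
  · rw [IsHermitian, conjTranspose_smul, conjTranspose_add, conjTranspose_conjTranspose, add_comm,
      star_trivial]
  · have h : (Gᴴ * X).trace.re = (G * X).trace.re := by
      rw [trace_mul_comm, ← hX.eq, ← conjTranspose_mul, trace_conjTranspose, hX.eq]
      simp
    rw [hG, smul_mul, trace_smul, Complex.smul_re, Matrix.add_mul, trace_add, Complex.add_re, h,
      smul_eq_mul]
    ring

variable {A B : Type*} [Fintype A] [Fintype B]

/-- The pairs `(P - Q, Tr_B (P + Q))` with `P, Q` positive semidefinite. -/
def differenceCone (A B : Type*) [Fintype A] [Fintype B] :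
    Set (Matrix (A × B) (A × B) ℂ × Matrix A A ℂ) :=
  {x | ∃ P Q : Matrix (A × B) (A × B) ℂ, P.PosSemidef ∧ Q.PosSemidef ∧
    x = (P - Q, partialTrace (P + Q))}

theorem smul_mem_differenceCone {x : Matrix (A × B) (A × B) ℂ × Matrix A A ℂ} {t : ℝ}
    (ht : 0 ≤ t) (hx : x ∈ differenceCone A B) : t • x ∈ differenceCone A B := by
  obtain ⟨P, Q, hP, hQ, rfl⟩ := hx
  refine ⟨t • P, t • Q, hP.smul ht, hQ.smul ht, ?_⟩
  rw [Prod.smul_mk, smul_sub, ← smul_add, LinearMap.map_smul_of_tower]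

theorem add_mem_differenceCone {x y : Matrix (A × B) (A × B) ℂ × Matrix A A ℂ}
    (hx : x ∈ differenceCone A B) (hy : y ∈ differenceCone A B) :
    x + y ∈ differenceCone A B := by
  obtain ⟨P, Q, hP, hQ, rfl⟩ := hx
  obtain ⟨P', Q', hP', hQ', rfl⟩ := hy
  refine ⟨P + P', Q + Q', hP.add hP', hQ.add hQ', ?_⟩
  rw [Prod.mk_add_mk, ← map_add]
  congr 2 <;> abel

theorem convex_differenceCone : Convex ℝ (differenceCone A B) :=
  fun _ hx _ hy _ _ ha hb _ =>
    add_mem_differenceCone (smul_mem_differenceCone ha hx) (smul_mem_differenceCone hb hy)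

/-- The second coordinate has trace `Tr P + Tr Q`, so near a limit point both `P` and `Q` range over
a compact set. -/
theorem isClosed_differenceCone : IsClosed (differenceCone A B) := by
  have hpt : Continuous (partialTrace : Matrix (A × B) (A × B) ℂ →ₗ[ℂ] Matrix A A ℂ) :=
    LinearMap.continuous_of_finiteDimensional _
  have hre : Continuous fun x : Matrix (A × B) (A × B) ℂ × Matrix A A ℂ => x.2.trace.re :=
    Complex.continuous_re.comp continuous_snd.matrix_trace
  refine isClosed_of_closure_subset fun y hy => ?_
  let r := y.2.trace.re + 1
  let D := {M : Matrix (A × B) (A × B) ℂ | M.PosSemidef ∧ M.trace.re ≤ r}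
  have hD : IsCompact D := isCompact_setOf_posSemidef_trace_le r
  let L : Matrix (A × B) (A × B) ℂ × Matrix (A × B) (A × B) ℂ →
      Matrix (A × B) (A × B) ℂ × Matrix A A ℂ := fun p => (p.1 - p.2, partialTrace (p.1 + p.2))
  have hL : Continuous L := by fun_prop
  have hc : IsClosed (L '' D ×ˢ D) := ((hD.prod hD).image hL).isClosed
  have hU : IsOpen {x : Matrix (A × B) (A × B) ℂ × Matrix A A ℂ | x.2.trace.re < r} :=
    isOpen_lt hre continuous_const
  have hy' := hU.inter_closure ⟨show y.2.trace.re < r by simp [r], hy⟩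
  have hsub : {x : Matrix (A × B) (A × B) ℂ × Matrix A A ℂ | x.2.trace.re < r} ∩
      differenceCone A B ⊆ L '' D ×ˢ D := by
    rintro _ ⟨hx, P, Q, hP, hQ, rfl⟩
    simp only [Set.mem_ofPred_eq, trace_partialTrace, trace_add, Complex.add_re] at hx
    have h1 := hP.re_trace_nonneg
    have h2 := hQ.re_trace_nonneg
    exact ⟨(P, Q), ⟨⟨hP, by linarith⟩, hQ, by linarith⟩, rfl⟩
  obtain ⟨⟨P, Q⟩, ⟨hP, hQ⟩, h⟩ := closure_minimal hsub hc hy'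
  exact ⟨P, Q, hP.1, hQ.1, h.symm⟩

variable [DecidableEq A] [DecidableEq B]

/-- Farkas alternative for membership in the difference cone. -/
theorem exists_dual_of_notMem_differenceCone {J : Matrix (A × B) (A × B) ℂ} (hJ : J.IsHermitian)
    (h : (J, 1) ∉ differenceCone A B) :
    ∃ (H : Matrix (A × B) (A × B) ℂ) (Y : Matrix A A ℂ),
      (Y ⊗ₖ (1 : Matrix B B ℂ) - H).PosSemidef ∧
        (Y ⊗ₖ (1 : Matrix B B ℂ) + H).PosSemidef ∧ Y.trace.re < (H * J).trace.re := by
  have h1 : LocallyConvexSpace ℝ (Matrix A A ℂ) :=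
    inferInstanceAs (LocallyConvexSpace ℝ (A → A → ℂ))
  have h2 : LocallyConvexSpace ℝ (Matrix (A × B) (A × B) ℂ) :=
    inferInstanceAs (LocallyConvexSpace ℝ (A × B → A × B → ℂ))
  obtain ⟨f, u, hf, hu⟩ := RCLike.geometric_hahn_banach_closed_point (𝕜 := ℂ)
    convex_differenceCone isClosed_differenceCone h
  have h0 : (0 : Matrix (A × B) (A × B) ℂ × Matrix A A ℂ) ∈ differenceCone A B :=
    ⟨0, 0, .zero, .zero, by simp [← Prod.zero_eq_mk]⟩
  have hu0 : 0 < u := by simpa using hf 0 h0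
  -- A positive value could be rescaled within the cone to equal `u`, against the strict bound `hf`.
  have hle (x) (hx : x ∈ differenceCone A B) : (f x).re ≤ 0 := by
    by_contra! hpos
    have := hf _ (smul_mem_differenceCone (t := u / (f x).re) (by positivity) hx)
    rw [ContinuousLinearMap.map_smul_of_tower] at this
    simp [hpos.ne'] at this
  obtain ⟨H, hH, hHf⟩ := exists_isHermitian_forall_re_eq_trace_mul
    (f.toLinearMap ∘ₗ LinearMap.inl ℂ (Matrix (A × B) (A × B) ℂ) (Matrix A A ℂ))
  obtain ⟨Y, hY, hYf⟩ := exists_isHermitian_forall_re_eq_trace_mul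
    (-(f.toLinearMap ∘ₗ LinearMap.inr ℂ (Matrix (A × B) (A × B) ℂ) (Matrix A A ℂ)))
  have hfx (M : Matrix (A × B) (A × B) ℂ) (W : Matrix A A ℂ) (hM : M.IsHermitian)
      (hW : W.IsHermitian) : (f (M, W)).re = (H * M).trace.re - (Y * W).trace.re := by
    have : (M, W) = LinearMap.inl ℂ _ _ M + LinearMap.inr ℂ _ _ W := by simp
    rw [← hHf M hM, ← hYf W hW, this, map_add, Complex.add_re]
    simp
  have hpt {P : Matrix (A × B) (A × B) ℂ} (hP : P.IsHermitian) :
      (partialTrace P).IsHermitian := by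
    ext a a'
    simp only [conjTranspose_apply, partialTrace_apply, star_sum]
    exact Finset.sum_congr rfl fun b _ => congrFun (congrFun hP.eq _) _
  have hYB : (Y ⊗ₖ (1 : Matrix B B ℂ)).IsHermitian := by
    rw [IsHermitian, conjTranspose_kronecker, hY.eq, conjTranspose_one]
  refine ⟨H, Y, ?_, ?_, ?_⟩
  -- The generators `(P, Tr_B P)` and, in the next case, `(-P, Tr_B P)` give the two operator
  -- inequalities.
  · refine (hYB.sub hH).posSemidef_of_re_trace_mul_nonneg fun P hP => ?_
    have := hle _ ⟨P, 0, hP, .zero, rfl⟩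
    rw [sub_zero, add_zero, hfx _ _ hP.1 (hpt hP.1), trace_mul_partialTrace] at this
    rw [Matrix.sub_mul, trace_sub, Complex.sub_re]
    linarith
  · refine (hYB.add hH).posSemidef_of_re_trace_mul_nonneg fun P hP => ?_
    have := hle _ ⟨0, P, .zero, hP, rfl⟩
    rw [zero_sub, zero_add, hfx _ _ hP.1.neg (hpt hP.1), trace_mul_partialTrace, Matrix.mul_neg,
      trace_neg, Complex.neg_re] at this
    rw [Matrix.add_mul, trace_add, Complex.add_re]
    linarith
  · have : 0 < (f (J, 1)).re := hu0.trans hu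
    rw [hfx _ _ hJ isHermitian_one, Matrix.mul_one] at this
    linarith

theorem exists_isUnit_dual [Nonempty B] {J H : Matrix (A × B) (A × B) ℂ} {Y : Matrix A A ℂ}
    (h1 : (Y ⊗ₖ (1 : Matrix B B ℂ) - H).PosSemidef)
    (h2 : (Y ⊗ₖ (1 : Matrix B B ℂ) + H).PosSemidef) (h : Y.trace.re < (H * J).trace.re) :
    ∃ S : Matrix A A ℂ, IsUnit S ∧ ((Sᴴ * S) ⊗ₖ (1 : Matrix B B ℂ) - H).PosSemidef ∧
        ((Sᴴ * S) ⊗ₖ (1 : Matrix B B ℂ) + H).PosSemidef ∧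
        (Sᴴ * S).trace.re < (H * J).trace.re := by
  obtain ⟨b⟩ := ‹Nonempty B›
  have hY : Y.PosSemidef := by
    -- Averaging the inequalities gives `Y ⊗ 1 ≥ 0`, whose block at `b` is `Y`.
    have := ((h1.add h2).smul (show (0 : ℝ) ≤ 1 / 2 by norm_num)).submatrix fun a : A => (a, b)
    convert this
    ext a a'
    simp
    ring
  -- Adding `ε • 1` raises the trace by `ε |A|`; the `+ 1` keeps this strictly below the gap.
  let ε : ℝ := ((H * J).trace.re - Y.trace.re) / (Fintype.card A + 1)
  have hε : 0 < ε := div_pos (by linarith) (by positivity)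
  have hpd : (Y + ε • (1 : Matrix A A ℂ)).PosDef := PosDef.posSemidef_add hY (PosDef.one.smul hε)
  obtain ⟨S, hS⟩ := hpd.posSemidef.exists_eq_conjTranspose_mul_self
  have hk : (Sᴴ * S) ⊗ₖ (1 : Matrix B B ℂ) = Y ⊗ₖ (1 : Matrix B B ℂ) + ε • 1 := by
    rw [← hS, add_kronecker, smul_kronecker, one_kronecker_one]
  have hεP : (ε • (1 : Matrix (A × B) (A × B) ℂ)).PosSemidef := PosSemidef.one.smul hε.le
  refine ⟨S, ?_, ?_, ?_, ?_⟩
  · have := hpd.isUnit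
    rw [hS, isUnit_iff_isUnit_det, det_mul] at this
    exact (isUnit_iff_isUnit_det S).2 (isUnit_of_mul_isUnit_right this)
  · rw [hk, add_sub_right_comm]
    exact h1.add hεP
  · rw [hk, add_right_comm]
    exact h2.add hεP
  · rw [← hS, trace_add, trace_smul, trace_one, Complex.add_re, Complex.smul_re,
      Complex.natCast_re, smul_eq_mul]
    have : ε * (Fintype.card A + 1) = (H * J).trace.re - Y.trace.re :=
      div_mul_cancel₀ _ (by positivity)
    linarith

/-- With `R = S ⊗ 1`, the operator `K = R⁻ᴴ H R⁻¹` is a contraction. On the normalized pure state of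
`S` the factors `R` cancel, so the pairing is `Tr (H J) / Tr (Sᴴ S)`. -/
theorem re_trace_mul_choi_le [Nonempty A] {E : OpMap A B}
    (h : ∀ ρ : Matrix (A × A) (A × A) ℂ, IsState ρ → ∀ K : Matrix (A × B) (A × B) ℂ,
      K.IsContraction → (K * idTensor A E ρ).trace.re ≤ 1)
    {H : Matrix (A × B) (A × B) ℂ} {S : Matrix A A ℂ} (hS : IsUnit S)
    (h1 : ((Sᴴ * S) ⊗ₖ (1 : Matrix B B ℂ) - H).PosSemidef)
    (h2 : ((Sᴴ * S) ⊗ₖ (1 : Matrix B B ℂ) + H).PosSemidef) :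
    (H * choi E).trace.re ≤ (Sᴴ * S).trace.re := by
  let τ : ℝ := (Sᴴ * S).trace.re
  have htr0 : 0 < (Sᴴ * S).trace :=
    (PosDef.conjTranspose_mul_self S (mulVec_injective_of_isUnit hS)).trace_pos
  have hτ : 0 < τ := (Complex.lt_def.1 htr0).1
  have hτ' : (τ : ℂ) = (Sᴴ * S).trace :=
    Complex.ext rfl (Complex.lt_def.1 htr0).2
  obtain ⟨T, hST⟩ := hS.exists_right_inv
  set R := S ⊗ₖ (1 : Matrix B B ℂ) with hR
  set R' := T ⊗ₖ (1 : Matrix B B ℂ) with hR'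
  have hRR : R * R' = 1 := by
    rw [hR, hR', ← mul_kronecker_mul, hST, Matrix.one_mul, one_kronecker_one]
  have hRR' : R' * R = 1 := mul_eq_one_comm.1 hRR
  have hRh : R'ᴴ * Rᴴ = 1 := by rw [← conjTranspose_mul, hRR, conjTranspose_one]
  have hRh' : Rᴴ * R'ᴴ = 1 := by rw [← conjTranspose_mul, hRR', conjTranspose_one]
  have hSR : (Sᴴ * S) ⊗ₖ (1 : Matrix B B ℂ) = Rᴴ * R := by
    rw [hR, conjTranspose_kronecker, ← mul_kronecker_mul, conjTranspose_one, Matrix.one_mul]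
  have hone : R'ᴴ * (Rᴴ * R) * R' = 1 := by
    rw [← Matrix.mul_assoc, hRh, Matrix.one_mul, hRR]
  rw [hSR] at h1 h2
  have hK : (R'ᴴ * H * R').IsContraction := by
    constructor
    · simpa only [Matrix.mul_sub, Matrix.sub_mul, hone] using h1.conjTranspose_mul_mul_same R'
    · simpa only [Matrix.mul_add, Matrix.add_mul, hone] using h2.conjTranspose_mul_mul_same R'
  have hρ : IsState (τ⁻¹ • pureOf S) := by
    refine ⟨(posSemidef_pureOf S).smul (inv_nonneg.2 hτ.le), ?_⟩
    rw [trace_smul, trace_pureOf, ← hτ', Complex.real_smul, ← Complex.ofReal_mul,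
      inv_mul_cancel₀ hτ.ne', Complex.ofReal_one]
  have htr : (R'ᴴ * H * R' * idTensor A E (pureOf S)).trace = (H * choi E).trace := by
    rw [idTensor_pureOf, ← hR, Matrix.mul_assoc, Matrix.mul_assoc, trace_mul_comm]
    simp only [Matrix.mul_assoc, hRh', Matrix.mul_one]
    rw [← Matrix.mul_assoc R', hRR', Matrix.one_mul]
  have := h _ hρ _ hK
  rw [LinearMap.map_smul_of_tower, Matrix.mul_smul, trace_smul, Complex.smul_re, htr, smul_eq_mul,
    inv_mul_le_iff₀ hτ, mul_one] at this
  exact this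

/-! ### Twisted channels as the diamond-norm unit ball, and the robustness. -/

theorem isTwistedChannel_of_re_trace_mul_idTensor_le [Nonempty A] [Nonempty B] {E : OpMap A B}
    (hE : IsHermitianPreserving E)
    (h : ∀ ρ : Matrix (A × A) (A × A) ℂ, IsState ρ → ∀ K : Matrix (A × B) (A × B) ℂ,
      K.IsContraction → (K * idTensor A E ρ).trace.re ≤ 1) : IsTwistedChannel E := by
  by_cases hmem : (choi E, 1) ∈ differenceCone A B
  · obtain ⟨P, Q, hP, hQ, hPQ⟩ := hmem
    rw [Prod.mk.injEq] at hPQ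
    rw [← ofChoi_choi E, hPQ.1]
    exact isTwistedChannel_ofChoi_sub hP hQ hPQ.2.symm
  · obtain ⟨H, Y, h1, h2, hlt⟩ :=
      exists_dual_of_notMem_differenceCone hE.isHermitian_choi hmem
    obtain ⟨S, hS, h1', h2', hlt'⟩ := exists_isUnit_dual h1 h2 hlt
    exact absurd (re_trace_mul_choi_le h hS h1' h2') (not_le.2 hlt')

theorem isTwistedChannel_smul [Nonempty A] [Nonempty B] {E : OpMap A B}
    (hE : IsHermitianPreserving E) {d c : ℝ} (hd : d ∈ upperBounds (diamondValues E))
    (hcd : |c| * d ≤ 1) : IsTwistedChannel (c • E) := by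
  refine isTwistedChannel_of_re_trace_mul_idTensor_le (hE.smul c) fun ρ hρ K hK => ?_
  have key (K : Matrix (A × B) (A × B) ℂ) (hK : K.IsContraction) :
      (K * idTensor A E ρ).trace.re ≤ d :=
    (re_trace_mul_le_traceNorm (hE.isHermitian_idTensor hρ.1.1) hK).trans (hd ⟨ρ, hρ, rfl⟩)
  have h1 := key K hK
  have h2 := key (-K) hK.neg
  rw [Matrix.neg_mul, trace_neg, Complex.neg_re] at h2
  rw [idTensor_smul, LinearMap.smul_apply, Matrix.mul_smul, trace_smul, Complex.smul_re, smul_eq_mul]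
  refine le_trans ?_ hcd
  rcases abs_cases c with ⟨hc, hc'⟩ | ⟨hc, hc'⟩ <;> rw [hc] <;> nlinarith

theorem isLeast_robustnessSet [Nonempty A] [Nonempty B] {E : OpMap A B}
    (hE : IsHermitianPreserving E) {d : ℝ} (hd : IsGreatest (diamondValues E) d) :
    IsLeast (robustnessSet E) (max 0 ((d - 1) / 2)) := by
  constructor
  · refine ⟨le_max_left _ _, ?_⟩
    rcases le_total d 1 with h | h
    · rw [max_eq_left (by linarith)]
      have hT : IsTwistedChannel ((1 : ℝ) • E) := isTwistedChannel_smul hE hd.2 (by simpa using h)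
      rw [one_smul] at hT
      exact ⟨E, hT, by simpa using hT⟩
    · have hd0 : 0 < d := by linarith
      rw [max_eq_right (by linarith)]
      -- For `t = (d - 1) / 2`, both `1 + t` and `d (1 - t / d)` equal `(d + 1) / 2`, so the mixture
      -- is `E / d`.
      refine ⟨(-d⁻¹) • E, isTwistedChannel_smul hE hd.2 ?_, ?_⟩
      · rw [abs_neg, abs_of_pos (inv_pos.2 hd0), inv_mul_cancel₀ hd0.ne']
      · have hE' : (1 + (d - 1) / 2)⁻¹ • (E + ((d - 1) / 2) • (-d⁻¹) • E) = d⁻¹ • E := by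
          have : E + ((d - 1) / 2) • (-d⁻¹) • E = (1 + (d - 1) / 2 * -d⁻¹) • E := by
            rw [add_smul, one_smul, mul_smul]
          rw [this, smul_smul]
          congr 1
          have : 1 + (d - 1) / 2 ≠ 0 := by linarith
          field_simp
          ring
        rw [hE']
        exact isTwistedChannel_smul hE hd.2
          (by rw [abs_of_pos (inv_pos.2 hd0), inv_mul_cancel₀ hd0.ne'])
  · rintro t ⟨ht, T, hT, hS⟩
    refine max_le ht ?_
    obtain ⟨ρ, hρ, rfl⟩ := hd.1
    obtain ⟨K, hK, hKeq⟩ := exists_isContraction_traceNorm_eq (hE.isHermitian_idTensor hρ.1.1)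
    -- At the optimal `ρ` and `K`, the mixture gives `d + t x ≤ 1 + t` and `T`, tested with `-K`,
    -- gives `-x ≤ 1`, where `x` is the pairing of `T` with `K`.
    have h1 := hS.re_trace_mul_idTensor_le hρ.1 hK
    have h2 := hT.re_trace_mul_idTensor_le hρ.1 hK.neg
    rw [idTensor_smul, idTensor_add, idTensor_smul, LinearMap.smul_apply, LinearMap.add_apply,
      LinearMap.smul_apply, Matrix.mul_smul, Matrix.mul_add, Matrix.mul_smul, trace_smul, trace_add, trace_smul,
      Complex.smul_re, Complex.add_re, Complex.smul_re, ← hKeq, hρ.2, Complex.one_re, smul_eq_mul,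
      smul_eq_mul, inv_mul_le_iff₀ (by linarith)] at h1
    rw [Matrix.neg_mul, trace_neg, Complex.neg_re, hρ.2, Complex.one_re] at h2
    nlinarith

end QuantumMap

theorem mainTheorem3 {A B : Type*} [Fintype A] [DecidableEq A] [Nonempty A]
    [Fintype B] [DecidableEq B] [Nonempty B]
    (E : QuantumMap.OpMap A B) (hE : QuantumMap.IsHermitianPreserving E) :
    IsGreatest (QuantumMap.diamondValues E) (QuantumMap.diamondNorm E) ∧
    IsLeast (QuantumMap.robustnessSet E) (QuantumMap.absoluteRobustness E) ∧
    QuantumMap.absoluteRobustness E = max 0 ((QuantumMap.diamondNorm E - 1) / 2) ∧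
    (1 ≤ QuantumMap.diamondNorm E →
      QuantumMap.absoluteRobustness E = (QuantumMap.diamondNorm E - 1) / 2 ∧
      QuantumMap.diamondNorm E = 2 * QuantumMap.absoluteRobustness E + 1) := by
  obtain ⟨d, hd⟩ := QuantumMap.exists_isGreatest_diamondValues hE
  have hdE : QuantumMap.diamondNorm E = d := hd.csSup_eq
  have hr := QuantumMap.isLeast_robustnessSet hE hd
  have hrE : QuantumMap.absoluteRobustness E = max 0 ((d - 1) / 2) := hr.csInf_eq
  rw [hdE, hrE]
  refine ⟨hd, hr, rfl, fun h => ?_⟩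
  rw [max_eq_right (by linarith)]
  exact ⟨rfl, by ring⟩
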